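/- Let $G$ be a countable discrete amenable group acting by homeomorphisms $T_g$, $g\in G$, on a compact metrizable space $X$, let $R$ be a commutative unital ring, and let $k\ge 0$ be an even integer. Then \[ \mathrm{mcid}_k(T;R)\le \mathrm{mdim}(T), \] where the two quantities are defined as follows. For closed $Y\subseteq X$, a \emph{finite open cover of $Y$ in $X$} is a finite set $\mathcal U$ of nonempty open subsets of $X$ whose union contains $Y$. Its order is $\mathrm{ord}(\mathcal U)=\max_{x\in X}\mathrm{Card}\{U\in\mathcal U: x\in U\}-1$, and $\mathcal D_Y(\mathcal U)$ is the least order of a finite open cover $\mathcal V$ of $Y$ in $X$ that refines $\mathcal U$ (every $V\in\mathcal V$ is contained in some $U\in\mathcal U$). For $F\subseteq G$ finite, $\bigvee_{g\in F}T_g^{-1}(\mathcal U)$ is the set of all nonempty sets $\bigcap_{g\in F}T_g^{-1}(U_g)$ with $U_g\in\mathcal U$. Let $\check H^k(Y;\mathcal U;R)$ be the set of those classes in the \v{C}ech cohomology $\check H^k(Y;R)$ that are represented by cocycles on the nerve of the cover $\{U\cap Y : U\in\mathcal U,\ U\cap Y\ne\varnothing\}$ of $Y$. For $G_0\subseteq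 G$ finite and $\delta>0$, a nonempty finite set $F\subseteq G$ is \emph{$(G_0,\delta)$-invariant} if $\mathrm{Card}(gF\cap F)>(1-\delta)\,\mathrm{Card}(F)$ for all $g\in G_0$. The \emph{mean dimension} $\mathrm{mdim}(T)\in[0,\infty]$ is \[ \mathrm{mdim}(T)=\sup_{\mathcal U}\ \lim_{F}\ \frac{\mathcal D_X\bigl(\bigvee_{g\in F}T_g^{-1}(\mathcal U)\bigr)}{\mathrm{Card}(F)}, \] where $\mathcal U$ runs over the finite open covers of $X$ and the limit is taken as $F$ becomes more and more invariant, that is, along the $(G_0,\delta)$-invariant sets as $G_0$ increases and $\delta\to0$ (and $\mathrm{mdim}(T)=0$ if $X=\varnothing$). The \emph{mean $k$-th cohomological independence dimension} $\mathrm{mcid}_k(T;R)$ is the largest $d\in[0,\infty)$ with the following property (and $0$ if there is no such $d$): for every $\varepsilon>0$ there are a closed set $Y\subseteq X$, a finite open cover $\mathcal U$ of $Y$ in $X$ with $\mathcal D_Y(\mathcal U)\in\{k,k+1\}$, and a class $\eta\in\check H^k(Y;\mathcal U;R)$, such that for every finite $G_0\subseteq G$ and every $\delta>0$ there are a $(G_0,\delta)$-invariant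 finite set $F\subseteq G$ and a subset $F_0\subseteq F$ such that \begin{enumerate} \item the cup product over all $g\in F_0$ of the restrictions of $T_g^*(\eta)$ to $\bigcap_{h\in F_0}T_h^{-1}(Y)$ is nonzero in $\check H^{k\,\mathrm{Card}(F_0)}\bigl(\bigcap_{h\in F_0}T_h^{-1}(Y);R\bigr)$ (the empty product is $1\in\check H^0(X;R)$), and \item $k\,\mathrm{Card}(F_0)/\mathrm{Card}(F)>d-\varepsilon$. \end{enumerate} -/

import Mathlib

open scoped ENNReal NNReal

noncomputable section

namespace MeanCoh

universe u v

/-! ### Čech cohomology with its cup product -/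

/-- An indexed finite open cover of a space (the index type has the universe of the space, so that
every finite set of open subsets occurs). Empty members are harmless: they span no simplices. -/
structure FinCover (Y : Type u) [TopologicalSpace Y] : Type (u + 1) where
  ι : Type u
  finite : Finite ι
  U : ι → Set Y
  isOpen : ∀ i, IsOpen (U i)
  covers : ⋃ i, U i = Set.univ

/-- The ordered `n`-simplices of the nerve of a family of sets: `(n+1)`-tuples of indices whose
sets have nonempty intersection. -/
def Simplex {Y : Type u} {ι : Type u} (U : ι → Set Y) (n : ℕ) : Type u :=
  {s : Fin (n + 1) → ι // (⋂ i, U (s i)).Nonempty}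

/-- Reindexing the vertices of a simplex. -/
def Simplex.comp {Y : Type u} {ι : Type u} {U : ι → Set Y} {n m : ℕ} (s : Simplex U n)
    (φ : Fin (m + 1) → Fin (n + 1)) : Simplex U m :=
  ⟨fun i => s.1 (φ i), s.2.mono fun _ hx => Set.mem_iInter.2 fun i => Set.mem_iInter.1 hx (φ i)⟩

/-- `n`-cochains of the nerve with coefficients in `R`. -/
abbrev Cochain {Y : Type u} {ι : Type u} (U : ι → Set Y) (R : Type v) (n : ℕ) : Type (max u v) :=
  Simplex U n → R

/-- The simplicial coboundary. -/
def coboundary {Y : Type u} {ι : Type u} {U : ι → Set Y} {R : Type v} [CommRing R] {n : ℕ}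
    (c : Cochain U R n) : Cochain U R (n + 1) :=
  fun s => ∑ i : Fin (n + 2), (-1) ^ (i : ℕ) * c (s.comp i.succAbove)

/-- `c` lies in the image of the coboundary; in degree `0` this means `c = 0`. -/
def IsCoboundary {Y : Type u} {ι : Type u} {U : ι → Set Y} {R : Type v} [CommRing R] {n : ℕ}
    (c : Cochain U R n) : Prop :=
  c = 0 ∨ ∃ (m : ℕ) (h : m + 1 = n) (e : Cochain U R m),
    ∀ s, c s = coboundary e (s.comp (Fin.cast (by rw [h])))

/-- The cup product of cochains: front `p`-face times back `q`-face. -/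
def cochainCup {Y : Type u} {ι : Type u} {U : ι → Set Y} {R : Type v} [CommRing R] {p q : ℕ}
    (a : Cochain U R p) (b : Cochain U R q) : Cochain U R (p + q) :=
  fun s => a (s.comp fun i => ⟨i, by omega⟩) * b (s.comp fun j => ⟨p + j, by omega⟩)

/-- Pull-back of cochains along a map of spaces `f` and a map of index sets `π` with
`f (V j) ⊆ U (π j)`. For `f = id` this is the map induced by a refinement. -/
def pull {Y Z : Type u} {ι κ : Type u} {U : ι → Set Y} {V : κ → Set Z} {R : Type v} {n : ℕ}
    (f : Z → Y) (π : κ → ι) (h : ∀ j, Set.MapsTo f (V j) (U (π j))) (c : Cochain U R n) :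
    Cochain V R n :=
  fun s => c ⟨fun i => π (s.1 i), by
    obtain ⟨x, hx⟩ := s.2
    exact ⟨f x, Set.mem_iInter.2 fun i => h _ (Set.mem_iInter.1 hx i)⟩⟩

section CochainLemmas

variable {Y Z : Type u} {ι κ : Type u} {U : ι → Set Y} {V : κ → Set Z} {R : Type v} [CommRing R]

theorem coboundary_pull {n : ℕ} (f : Z → Y) (π : κ → ι) (h : ∀ j, Set.MapsTo f (V j) (U (π j)))
    (c : Cochain U R n) : coboundary (pull f π h c) = pull f π h (coboundary c) := rfl

theorem coboundary_pull_eq_zero {n : ℕ} (f : Z → Y) (π : κ → ι)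
    (h : ∀ j, Set.MapsTo f (V j) (U (π j))) {c : Cochain U R n} (hc : coboundary c = 0) :
    coboundary (pull f π h c) = 0 := by
  rw [coboundary_pull, hc]
  rfl

theorem cochainCup_pull {p q : ℕ} (f : Z → Y) (π : κ → ι)
    (h : ∀ j, Set.MapsTo f (V j) (U (π j))) (a : Cochain U R p) (b : Cochain U R q) :
    cochainCup (pull f π h a) (pull f π h b) = pull f π h (cochainCup a b) := rfl

theorem IsCoboundary.pull {n : ℕ} (f : Z → Y) (π : κ → ι)
    (h : ∀ j, Set.MapsTo f (V j) (U (π j))) {c : Cochain U R n} (hc : IsCoboundary c) :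
    IsCoboundary (pull f π h c) := by
  rcases hc with rfl | ⟨m, hm, e, he⟩
  · exact Or.inl rfl
  · exact Or.inr ⟨m, hm, MeanCoh.pull f π h e, fun s => he _⟩

/-- The Leibniz rule. -/
theorem coboundary_cup {p q : ℕ} (a : Cochain U R p) (b : Cochain U R q)
    (s : Simplex U (p + q + 1)) :
    coboundary (cochainCup a b) s =
      cochainCup (coboundary a) b (s.comp (m := p + 1 + q) (Fin.cast (by omega))) +
        (-1) ^ p * cochainCup a (coboundary b) s := by
  have e : (p + 1) + (q + 1) = p + q + 2 := by omega
  have key : coboundary (cochainCup a b) s =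
      (∑ i : Fin (p + 1), (-1) ^ (i : ℕ) *
        cochainCup a b (s.comp (Fin.succAbove ⟨i, by omega⟩))) +
      ∑ j : Fin (q + 1), (-1) ^ (p + 1 + j : ℕ) *
        cochainCup a b (s.comp (Fin.succAbove ⟨p + 1 + j, by omega⟩)) := by
    unfold coboundary
    rw [← (finCongr e).sum_comp, Fin.sum_univ_add]
    rfl
  rw [key]
  simp only [cochainCup, coboundary]
  conv_rhs =>
    rw [Fin.sum_univ_castSucc, add_mul, Finset.sum_mul]
    rw [Fin.sum_univ_succ (n := q + 1), mul_add, mul_add, Finset.mul_sum, Finset.mul_sum]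
  have h1 : ∀ i : Fin (p + 1),
      (-1) ^ (i : ℕ) *
        (a ((s.comp (Fin.succAbove ⟨i, by omega⟩)).comp (m := p) fun i => ⟨i, by omega⟩) *
          b ((s.comp (Fin.succAbove ⟨i, by omega⟩)).comp (m := q) fun j => ⟨p + j, by omega⟩)) =
      (-1) ^ (i.castSucc : ℕ) *
        a (((s.comp (m := p + 1 + q) (Fin.cast (by omega))).comp (m := p + 1)
          fun i => ⟨i, by omega⟩).comp i.castSucc.succAbove) *
        b ((s.comp (m := p + 1 + q) (Fin.cast (by omega))).comp (m := q)
          fun j => ⟨p + 1 + j, by omega⟩) := by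
    intro i
    rw [mul_assoc]
    congr 2
    · congr 1
      apply Subtype.ext
      funext j
      refine congrArg s.1 (Fin.ext ?_)
      simp only [Fin.succAbove, Fin.lt_def, Fin.val_cast, Fin.val_castSucc]
      split_ifs <;> simp
    · congr 1
      apply Subtype.ext
      funext j
      refine congrArg s.1 (Fin.ext ?_)
      simp only [Fin.succAbove, Fin.lt_def, Fin.val_cast, Fin.val_castSucc]
      rw [if_neg (by omega)]
      simp
      omega
  have h2 : ∀ j : Fin (q + 1),
      (-1) ^ (p + 1 + j : ℕ) *
        (a ((s.comp (Fin.succAbove ⟨p + 1 + j, by omega⟩)).comp (m := p) fun i => ⟨i, by omega⟩) *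
          b ((s.comp (Fin.succAbove ⟨p + 1 + j, by omega⟩)).comp (m := q)
            fun j => ⟨p + j, by omega⟩)) =
      (-1) ^ p * (a (s.comp (m := p) fun i => ⟨i, by omega⟩) *
        ((-1) ^ (j.succ : ℕ) *
          b ((s.comp (m := q + 1) fun j => ⟨p + j, by omega⟩).comp j.succ.succAbove))) := by
    intro j
    have ha : ((s.comp (Fin.succAbove ⟨p + 1 + j, by omega⟩)).comp (m := p)
        fun i => ⟨i, by omega⟩) = s.comp (m := p) fun i => ⟨i, by omega⟩ := by
      apply Subtype.ext
      funext i
      refine congrArg s.1 (Fin.ext ?_)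
      simp only [Fin.succAbove, Fin.lt_def, Fin.val_castSucc]
      rw [if_pos (by omega)]
      simp
    have hb : ((s.comp (Fin.succAbove ⟨p + 1 + j, by omega⟩)).comp (m := q)
        fun j => ⟨p + j, by omega⟩) =
        (s.comp (m := q + 1) fun j => ⟨p + j, by omega⟩).comp j.succ.succAbove := by
      apply Subtype.ext
      funext i
      refine congrArg s.1 (Fin.ext ?_)
      simp only [Fin.succAbove, Fin.lt_def, Fin.val_castSucc, Fin.val_succ]
      split_ifs <;> simp <;> omega
    rw [ha, hb, Fin.val_succ]
    ring
  rw [Finset.sum_congr rfl fun i _ => h1 i, Finset.sum_congr rfl fun j _ => h2 j]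
  have h3 : a (((s.comp (m := p + 1 + q) (Fin.cast (by omega))).comp (m := p + 1)
          fun i => ⟨i, by omega⟩).comp (Fin.last (p + 1)).succAbove) =
      a (s.comp (m := p) fun i => ⟨i, by omega⟩) := by
    congr 1
    apply Subtype.ext
    funext i
    refine congrArg s.1 (Fin.ext ?_)
    simp
  have h4 : b ((s.comp (m := q + 1) fun j => ⟨p + j, by omega⟩).comp (0 : Fin (q + 2)).succAbove) =
      b ((s.comp (m := p + 1 + q) (Fin.cast (by omega))).comp (m := q)
          fun j => ⟨p + 1 + j, by omega⟩) := by
    congr 1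
    apply Subtype.ext
    funext i
    refine congrArg s.1 (Fin.ext ?_)
    simp
    omega
  rw [h3, h4]
  simp only [Fin.val_last, Fin.val_zero]
  ring

theorem coboundary_zero {n : ℕ} : coboundary (0 : Cochain U R n) = 0 := by
  funext s
  simp [coboundary]

theorem coboundary_cup_eq_zero {p q : ℕ} {a : Cochain U R p} {b : Cochain U R q}
    (ha : coboundary a = 0) (hb : coboundary b = 0) : coboundary (cochainCup a b) = 0 := by
  funext s
  rw [coboundary_cup, ha, hb]
  simp [cochainCup]

theorem IsCoboundary.cup_right {p q : ℕ} {a : Cochain U R p} {b : Cochain U R q}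
    (ha : IsCoboundary a) (hb : coboundary b = 0) : IsCoboundary (cochainCup a b) := by
  rcases ha with rfl | ⟨m, rfl, e, he⟩
  · exact Or.inl (by funext s; simp [cochainCup])
  · refine Or.inr ⟨m + q, by omega, cochainCup e b, fun s => ?_⟩
    obtain rfl : a = coboundary e := funext he
    rw [coboundary_cup, hb]
    simp only [cochainCup, Pi.zero_apply, mul_zero, add_zero]
    rfl

theorem IsCoboundary.cup_left {p q : ℕ} {a : Cochain U R p} {b : Cochain U R q}
    (ha : coboundary a = 0) (hb : IsCoboundary b) : IsCoboundary (cochainCup a b) := by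
  rcases hb with rfl | ⟨m, rfl, e, he⟩
  · exact Or.inl (by funext s; simp [cochainCup])
  · refine Or.inr ⟨p + m, by omega, cochainCup ((-1) ^ p * a) e, fun s => ?_⟩
    obtain rfl : b = coboundary e := funext he
    have ha' : coboundary ((-1) ^ p * a) = 0 := by
      funext s
      have := congrFun ha s
      simp only [coboundary, Pi.zero_apply] at this
      simp only [coboundary, Pi.mul_apply, Pi.pow_apply, Pi.neg_apply, Pi.one_apply,
        Pi.zero_apply]
      simp_rw [mul_left_comm _ ((-1 : R) ^ p)]
      rw [← Finset.mul_sum, this, mul_zero]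
    rw [coboundary_cup, ha']
    simp only [cochainCup, Pi.zero_apply, zero_mul, zero_add, Pi.mul_apply, Pi.pow_apply,
      Pi.neg_apply, Pi.one_apply]
    rw [← mul_assoc, ← mul_assoc, ← pow_add, Even.neg_one_pow ⟨p, rfl⟩, one_mul]
    rfl

end CochainLemmas

/-- An `n`-cocycle on the nerve of some finite open cover of `Y`. -/
structure CechCocycle (Y : Type u) [TopologicalSpace Y] (R : Type v) [CommRing R] (n : ℕ) :
    Type (max (u + 1) v) where
  cover : FinCover Y
  cochain : Cochain cover.U R n
  closed : coboundary cochain = 0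

/-- `y` lives on a refinement of the cover of `x` and is there cohomologous to the pull-back
of `x`. -/
def CechCocycle.Rel {Y : Type u} [TopologicalSpace Y] {R : Type v} [CommRing R] {n : ℕ}
    (x y : CechCocycle Y R n) : Prop :=
  ∃ (π : y.cover.ι → x.cover.ι) (h : ∀ j, Set.MapsTo id (y.cover.U j) (x.cover.U (π j))),
    IsCoboundary (y.cochain - pull id π h x.cochain)

/-- Čech cohomology (of a compact space): the direct limit, over finite open covers and
refinements, of the cohomology of nerves. `Quot` divides by the equivalence relation generated
by `Rel`, which is precisely the one defining this direct limit. -/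
def CechH (Y : Type u) [TopologicalSpace Y] (R : Type v) [CommRing R] (n : ℕ) :
    Type (max (u + 1) v) :=
  Quot (CechCocycle.Rel (Y := Y) (R := R) (n := n))

section CechOps

variable {Y Z : Type u} [TopologicalSpace Y] [TopologicalSpace Z] {R : Type v} [CommRing R]

/-- The one-element cover. -/
abbrev FinCover.trivial (Y : Type u) [TopologicalSpace Y] : FinCover Y where
  ι := PUnit
  finite := inferInstance
  U := fun _ => Set.univ
  isOpen := fun _ => isOpen_univ
  covers := Set.iUnion_const _

/-- The common refinement of two covers. -/
abbrev FinCover.join (𝒰 𝒱 : FinCover Y) : FinCover Y where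
  ι := 𝒰.ι × 𝒱.ι
  finite := by
    have := 𝒰.finite
    have := 𝒱.finite
    infer_instance
  U := fun i => 𝒰.U i.1 ∩ 𝒱.U i.2
  isOpen := fun i => (𝒰.isOpen i.1).inter (𝒱.isOpen i.2)
  covers := by
    refine Set.eq_univ_of_forall fun x => ?_
    obtain ⟨i, hi⟩ := Set.mem_iUnion.1 (𝒰.covers ▸ Set.mem_univ x)
    obtain ⟨j, hj⟩ := Set.mem_iUnion.1 (𝒱.covers ▸ Set.mem_univ x)
    exact Set.mem_iUnion.2 ⟨(i, j), hi, hj⟩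

/-- The preimage of a cover under a continuous map. -/
abbrev FinCover.preimage (f : C(Z, Y)) (𝒰 : FinCover Y) : FinCover Z where
  ι := 𝒰.ι
  finite := 𝒰.finite
  U := fun i => f ⁻¹' 𝒰.U i
  isOpen := fun i => (𝒰.isOpen i).preimage f.continuous
  covers := by rw [← Set.preimage_iUnion, 𝒰.covers, Set.preimage_univ]

/-- The zero class. -/
instance CechH.instZero (n : ℕ) : Zero (CechH Y R n) :=
  ⟨Quot.mk _ ⟨FinCover.trivial Y, 0, coboundary_zero⟩⟩

/-- The unit class in degree `0`. -/
instance CechH.instOne : One (CechH Y R 0) :=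
  ⟨Quot.mk _ ⟨FinCover.trivial Y, 1, by
    funext s
    simp [coboundary, Fin.sum_univ_succ]⟩⟩

/-- The homomorphism `f^*` induced by a continuous map. -/
def CechH.map (f : C(Z, Y)) {n : ℕ} : CechH Y R n → CechH Z R n :=
  Quot.map
    (fun x => ⟨x.cover.preimage f, pull f id (fun _ _ hz => hz) x.cochain, 
      coboundary_pull_eq_zero _ _ _ x.closed⟩)
    (by
      rintro x y ⟨π, h, hc⟩
      exact ⟨π, fun j _ hz => h j hz, hc.pull f id (fun _ _ hz => hz)⟩)

/-- The cup product of two cocycles: pull both back to the common refinement and multiply. -/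
abbrev CechCocycle.cup {p q : ℕ} (x : CechCocycle Y R p) (y : CechCocycle Y R q) :
    CechCocycle Y R (p + q) where
  cover := x.cover.join y.cover
  cochain := cochainCup (pull id Prod.fst (fun _ _ hz => hz.1) x.cochain)
    (pull id Prod.snd (fun _ _ hz => hz.2) y.cochain)
  closed := coboundary_cup_eq_zero
    (coboundary_pull_eq_zero _ _ _ x.closed) (coboundary_pull_eq_zero _ _ _ y.closed)

/-- The cup product in Čech cohomology. -/
def CechH.cup {p q : ℕ} : CechH Y R p → CechH Y R q → CechH Y R (p + q) :=
  Quot.map₂ CechCocycle.cup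
    (by
      rintro x y y' ⟨π, h, hc⟩
      refine ⟨Prod.map id π, fun j z hz => ⟨hz.1, h _ hz.2⟩, ?_⟩
      have key := IsCoboundary.cup_left
        (a := pull (V := (x.cover.join y'.cover).U) id Prod.fst (fun _ _ hz => hz.1) x.cochain)
        (coboundary_pull_eq_zero _ _ _ x.closed)
        (hc.pull (V := (x.cover.join y'.cover).U) id Prod.snd (fun _ _ hz => hz.2))
      refine (congrArg IsCoboundary ?_).mpr key
      funext s
      exact (mul_sub _ _ _).symm)
    (by
      rintro x x' y ⟨π, h, hc⟩
      refine ⟨Prod.map π id, fun j z hz => ⟨h _ hz.1, hz.2⟩, ?_⟩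
      have key := IsCoboundary.cup_right
        (b := pull (V := (x'.cover.join y.cover).U) id Prod.snd (fun _ _ hz => hz.2) y.cochain)
        (hc.pull (V := (x'.cover.join y.cover).U) id Prod.fst (fun _ _ hz => hz.1))
        (coboundary_pull_eq_zero _ _ _ y.closed)
      refine (congrArg IsCoboundary ?_).mpr key
      funext s
      exact (sub_mul _ _ _).symm)

/-- The cup product of a list of classes of degree `k`; the empty product is `1`. -/
def CechH.cupList {k : ℕ} : (l : List (CechH Y R k)) → CechH Y R (k * l.length)
  | [] => (1 : CechH Y R 0)
  | η :: l => CechH.cup (CechH.cupList l) η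

end CechOps

/-! ### Covers of closed subsets -/

section Covers

variable {X : Type u} [TopologicalSpace X]

/-- `𝒰` is a finite open cover of `Y` in `X`: finitely many nonempty open subsets of `X` whose
union contains `Y`. -/
structure IsFinOpenCover (Y : Set X) (𝒰 : Set (Set X)) : Prop where
  finite : 𝒰.Finite
  isOpen : ∀ U ∈ 𝒰, IsOpen U
  nonempty : ∀ U ∈ 𝒰, U.Nonempty
  covers : Y ⊆ ⋃₀ 𝒰

/-- The order of a finite collection of sets: the maximal number of members with a common point,
minus one (so `-1` for the empty collection). -/
def ord (𝒰 : Set (Set X)) : ℤ :=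
  ((⨆ x : X, {U ∈ 𝒰 | x ∈ U}.ncard : ℕ) : ℤ) - 1

/-- `𝒱` refines `𝒰`. -/
def Refines (𝒱 𝒰 : Set (Set X)) : Prop :=
  ∀ V ∈ 𝒱, ∃ U ∈ 𝒰, V ⊆ U

/-- `𝒟_Y(𝒰)`: the least order of a refinement of `𝒰` among finite open covers of `Y` in `X`. -/
def coverDim (Y : Set X) (𝒰 : Set (Set X)) : ℤ :=
  sInf {n | ∃ 𝒱, IsFinOpenCover Y 𝒱 ∧ Refines 𝒱 𝒰 ∧ ord 𝒱 = n}

/-- `𝒰 ∩ Y`: the nonempty sets `U ∩ Y`, `U ∈ 𝒰`, as subsets of the space `Y`. -/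
def restrictCover (Y : Set X) (𝒰 : Set (Set X)) : Set (Set Y) :=
  {V | V.Nonempty ∧ ∃ U ∈ 𝒰, V = Subtype.val ⁻¹' U}

/-- `𝒰 ∩ Y` as a cover of the space `Y`, indexed by its own members. -/
abbrev IsFinOpenCover.restrict {Y : Set X} {𝒰 : Set (Set X)} (h : IsFinOpenCover Y 𝒰) :
    FinCover Y where
  ι := restrictCover Y 𝒰
  finite := by
    refine Set.Finite.to_subtype ((h.finite.image fun U => (Subtype.val ⁻¹' U : Set Y)).subset ?_)
    rintro V ⟨-, U, hU, rfl⟩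
    exact ⟨U, hU, rfl⟩
  U := fun V => V.1
  isOpen := by
    rintro ⟨V, -, U, hU, rfl⟩
    exact (h.isOpen U hU).preimage continuous_subtype_val
  covers := by
    refine Set.eq_univ_of_forall fun y => ?_
    obtain ⟨U, hU, hy⟩ := h.covers y.2
    exact Set.mem_iUnion.2 ⟨⟨Subtype.val ⁻¹' U, ⟨y, hy⟩, U, hU, rfl⟩, hy⟩

/-- `Ȟᵏ(Y; 𝒰; R)`: the classes in `Ȟᵏ(Y; R)` represented by cocycles on the nerve of `𝒰 ∩ Y`. -/
def cechFrom {Y : Set X} {𝒰 : Set (Set X)} (h : IsFinOpenCover Y 𝒰) (R : Type v) [CommRing R]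
    (k : ℕ) : Set (CechH Y R k) :=
  {η | ∃ (c : Cochain h.restrict.U R k) (hc : coboundary c = 0),
    η = Quot.mk _ ⟨h.restrict, c, hc⟩}

end Covers

/-! ### Amenable groups, mean dimension -/

/-- A nonempty finite set `F ⊆ G` with `|gF ∩ F| > (1 - δ)|F|` for all `g ∈ G₀`. -/
def IsInvariant {G : Type*} [Group G] (G₀ : Finset G) (δ : ℝ) (F : Finset G) : Prop :=
  F.Nonempty ∧
    ∀ g ∈ G₀, (1 - δ) * (F.card : ℝ) < (((g * ·) '' (F : Set G) ∩ F).ncard : ℝ)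

/-- Amenability of a discrete group (Følner's condition). -/
def IsAmenable (G : Type*) [Group G] : Prop :=
  ∀ (G₀ : Finset G) (δ : ℝ), 0 < δ → ∃ F : Finset G, IsInvariant G₀ δ F

section Dynamics

variable (G : Type*) [Group G] (X : Type u) [TopologicalSpace X] [MulAction G X]

/-- The join of the covers `T_g⁻¹(𝒰)`, `g ∈ F`: all nonempty sets `⋂_{g ∈ F} T_g⁻¹(U_g)` with
`U_g ∈ 𝒰`. -/
def dynJoin {G : Type*} [Group G] {X : Type u} [MulAction G X] (F : Finset G)
    (𝒰 : Set (Set X)) : Set (Set X) :=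
  {W | W.Nonempty ∧ ∃ V : G → Set X, (∀ g ∈ F, V g ∈ 𝒰) ∧ W = ⋂ g ∈ F, {x | g • x ∈ V g}}

/-- Mean dimension: the supremum over finite open covers `𝒰` of `X` of the limit of
`𝒟(⋁_{g ∈ F} T_g⁻¹ 𝒰) / |F|` as `F` becomes more and more invariant. The limit exists for
amenable groups (Ornstein and Weiss), so it is written as an upper limit. -/
def mdim : ℝ≥0∞ :=
  ⨆ (𝒰 : Set (Set X)) (_ : IsFinOpenCover Set.univ 𝒰),
    ⨅ (G₀ : Finset G) (δ : ℝ) (_ : 0 < δ),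
      ⨆ (F : Finset G) (_ : IsInvariant G₀ δ F),
        ENNReal.ofReal ((coverDim Set.univ (dynJoin F 𝒰) : ℝ) / F.card)

variable {G X}

/-- `⋂_{h ∈ F₀} T_h⁻¹(Y)`. -/
def interPreimage (F₀ : Finset G) (Y : Set X) : Set X :=
  {x | ∀ h ∈ F₀, h • x ∈ Y}

/-- For `g ∈ F₀`, the map `⋂_{h ∈ F₀} T_h⁻¹(Y) → Y`, `x ↦ T_g x`. Pulling back along it is
applying `T_g^*` and restricting to the intersection. -/
def translate [ContinuousConstSMul G X] (F₀ : Finset G) (Y : Set X) (g : F₀) :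
    C(interPreimage F₀ Y, Y) where
  toFun x := ⟨g.1 • x.1, x.2 g.1 g.2⟩
  continuous_toFun := (continuous_subtype_val.const_smul g.1).subtype_mk _

/-- The cup product of the classes `T_g^*(η)`, in the order given by the list `l`. -/
def orbitCup [ContinuousConstSMul G X] {R : Type v} [CommRing R] {k : ℕ} (F₀ : Finset G)
    (Y : Set X) (η : CechH Y R k) (l : List F₀) :
    CechH (interPreimage F₀ Y) R (k * (l.map fun g => CechH.map (translate F₀ Y g) η).length) :=
  CechH.cupList (l.map fun g => CechH.map (translate F₀ Y g) η)

variable (G X)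

/-- The condition on `d` in the definition of `mcid_k(T; R)`. The cup product over `F₀` is taken
along an enumeration of `F₀`; for even `k` classes of degree `k` commute, so that the
enumeration is irrelevant. -/
def McidCondition [ContinuousConstSMul G X] (R : Type v) [CommRing R] (k : ℕ) (d : ℝ) : Prop :=
  ∀ ε : ℝ, 0 < ε →
    ∃ (Y : Set X) (_ : IsClosed Y) (𝒰 : Set (Set X)) (h𝒰 : IsFinOpenCover Y 𝒰)
      (_ : coverDim Y 𝒰 = k ∨ coverDim Y 𝒰 = k + 1) (η : CechH Y R k) (_ : η ∈ cechFrom h𝒰 R k),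
      ∀ (G₀ : Finset G) (δ : ℝ), 0 < δ →
        ∃ (F : Finset G) (_ : IsInvariant G₀ δ F) (F₀ : Finset G) (_ : F₀ ⊆ F),
          (∃ l : List F₀, l.Nodup ∧ (∀ g, g ∈ l) ∧ orbitCup F₀ Y η l ≠ 0) ∧
          d - ε < (k : ℝ) * F₀.card / F.card

/-- The mean `k`-th cohomological independence dimension with coefficients in `R`: the largest
`d ∈ [0, ∞)` with the above condition. The set of such `d` is empty or of the form `[0, r]` with
`r ≤ k`; the value is `0` if it is empty. -/
def mcid [ContinuousConstSMul G X] (R : Type v) [CommRing R] (k : ℕ) : ℝ≥0∞ :=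
  ⨆ (d : ℝ≥0) (_ : McidCondition G X R k d), (d : ℝ≥0∞)

end Dynamics

end MeanCoh

end

/-!
If a finite open cover `𝒱` of `X` refines `⋁_{g ∈ F} T_g⁻¹(𝒰 ∪ {X \ Y})`, then on
`⋂_{h ∈ F₀} T_h⁻¹(Y)` with `F₀ ⊆ F` its trace refines every `T_g⁻¹(𝒰)` with `g ∈ F₀`, because a
member of `𝒱` that meets this set cannot be mapped into `X \ Y`. Hence the cup product of the
classes `T_g^*(η)` is represented on the nerve of this trace, and it vanishes as soon as its degree
exceeds the order of `𝒱`. A nonzero product therefore bounds `𝒟` from below by its degree.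

Cochains here are functions on all ordered simplices, degenerate ones included, so the vanishing
above the dimension of the nerve needs an argument. Barycentric subdivision followed by a choice of
a vertex in every face is a chain map that kills the simplices with a repeated vertex. Like the
identity it maps a simplex into the full simplex on its vertices, which is acyclic, so the two are
chain homotopic, and the homotopy exhibits every cocycle in such a degree as a coboundary.
-/

noncomputable section

namespace MeanCoh

universe u v

section OrderedChains

variable {ι R M N : Type*} [Ring R] [AddCommGroup M] [Module R M] [AddCommGroup N] [Module R N]
  {m n : ℕ}

/-- Ordered chains with `n` vertices, in simplicial degree `n - 1`. The empty tuple is allowed, so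
that these modules form the augmented complex. -/
abbrev OrderedChain (R ι : Type*) [Ring R] (n : ℕ) : Type _ :=
  (Fin n → ι) →₀ R

namespace OrderedChain

/-- The cone operator, which prepends the vertex `v` to every simplex. -/
def cone (v : ι) : OrderedChain R ι n →ₗ[R] OrderedChain R ι (n + 1) :=
  Finsupp.lmapDomain R R (Fin.cons (α := fun _ => ι) v)

@[simp]
theorem cone_single (v : ι) (s : Fin n → ι) (r : R) :
    cone v (Finsupp.single s r) = Finsupp.single (Fin.cons v s : Fin (n + 1) → ι) r :=
  Finsupp.mapDomain_single

/-- The boundary operator; on chains with one vertex it is the augmentation. -/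
def boundary : OrderedChain R ι (n + 1) →ₗ[R] OrderedChain R ι n :=
  Finsupp.linearCombination R fun s =>
    ∑ i : Fin (n + 1), Finsupp.single (s ∘ i.succAbove) ((-1) ^ (i : ℕ))

theorem boundary_single (s : Fin (n + 1) → ι) :
    boundary (Finsupp.single s (1 : R)) =
      ∑ i : Fin (n + 1), Finsupp.single (s ∘ i.succAbove) ((-1) ^ (i : ℕ)) := by
  simp [boundary]

theorem boundary_cone_zero (v : ι) (x : OrderedChain R ι 0) : boundary (cone v x) = x := by
  suffices boundary ∘ₗ cone v = LinearMap.id from LinearMap.congr_fun this x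
  ext s : 2
  simp [boundary_single, Subsingleton.elim _ s]

theorem boundary_cone (v : ι) (x : OrderedChain R ι (n + 1)) :
    boundary (cone v x) = x - cone v (boundary x) := by
  suffices boundary ∘ₗ cone v = LinearMap.id - cone v ∘ₗ boundary from LinearMap.congr_fun this x
  ext s : 2
  simp only [LinearMap.comp_apply, Finsupp.lsingle_apply, LinearMap.sub_apply, LinearMap.id_apply,
    cone_single, boundary_single, map_sum, Fin.sum_univ_succ (n := n + 1), sub_eq_add_neg,
    ← Finset.sum_neg_distrib, ← Finsupp.single_neg]
  congr 1
  · simp [Function.comp_def]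
  · refine Finset.sum_congr rfl fun i _ => ?_
    rw [Fin.cons_comp_succ_succAbove, Fin.val_succ, pow_succ, mul_neg_one]
    rfl

theorem boundary_boundary (x : OrderedChain R ι (n + 2)) : boundary (boundary x) = 0 := by
  suffices (boundary ∘ₗ boundary : OrderedChain R ι (n + 2) →ₗ[R] _) = 0 from
    LinearMap.congr_fun this x
  ext s : 2
  obtain ⟨v, t, rfl⟩ : ∃ v t, s = Fin.cons v t := ⟨_, _, (Fin.cons_self_tail s).symm⟩
  simp only [LinearMap.comp_apply, Finsupp.lsingle_apply, LinearMap.zero_apply, ← cone_single]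
  clear x
  induction n generalizing v with
  | zero => rw [boundary_cone, map_sub, boundary_cone_zero, sub_self]
  | succ n ih =>
    obtain ⟨w, u, rfl⟩ : ∃ w u, t = Fin.cons w u := ⟨_, _, (Fin.cons_self_tail t).symm⟩
    rw [boundary_cone, map_sub, boundary_cone, ← cone_single w, ih w u, map_zero, sub_zero,
      sub_self]

/-- The chains all of whose vertices lie in `S`. -/
def onVertices (R : Type*) [Ring R] (S : Set ι) (n : ℕ) : Submodule R (OrderedChain R ι n) :=
  Finsupp.supported R R {s | ∀ i, s i ∈ S}

theorem single_mem_onVertices {S : Set ι} {s : Fin n → ι} (hs : ∀ i, s i ∈ S) (r : R) :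
    Finsupp.single s r ∈ onVertices R S n :=
  Finsupp.single_mem_supported R r hs

theorem onVertices_le_iff {S : Set ι} {P : Submodule R (OrderedChain R ι n)} :
    onVertices R S n ≤ P ↔ ∀ s : Fin n → ι, (∀ i, s i ∈ S) → Finsupp.single s 1 ∈ P := by
  rw [onVertices, Finsupp.supported_eq_span_single, Submodule.span_le, Set.image_subset_iff]
  rfl

theorem cone_mem_onVertices {S : Set ι} {v : ι} (hv : v ∈ S) {x : OrderedChain R ι n}
    (hx : x ∈ onVertices R S n) : cone v x ∈ onVertices R S (n + 1) := by
  suffices onVertices R S n ≤ (onVertices R S (n + 1)).comap (cone v) from this hx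
  refine onVertices_le_iff.2 fun s hs => ?_
  rw [Submodule.mem_comap, cone_single]
  exact single_mem_onVertices (Fin.cases hv hs) 1

/-- The linear map `f` does not introduce vertices: it is carried by the carrier sending a simplex
to the full simplex on its vertices. -/
def PreservesVertices (f : OrderedChain R ι m →ₗ[R] OrderedChain R ι n) : Prop :=
  ∀ S, onVertices R S m ≤ (onVertices R S n).comap f

theorem PreservesVertices.of_single {f : OrderedChain R ι m →ₗ[R] OrderedChain R ι n}
    (h : ∀ (S : Set ι) (s : Fin m → ι), (∀ i, s i ∈ S) →
      f (Finsupp.single s 1) ∈ onVertices R S n) : PreservesVertices f :=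
  fun S => onVertices_le_iff.2 (h S)

theorem preservesVertices_boundary :
    PreservesVertices (boundary : OrderedChain R ι (n + 1) →ₗ[R] OrderedChain R ι n) := by
  refine .of_single fun S s hs => ?_
  rw [boundary_single]
  exact Submodule.sum_mem _ fun i _ => single_mem_onVertices (fun j => hs (i.succAbove j)) _

/-! ### Acyclic carriers -/

/-- The chain homotopy from the identity to `f` provided by the method of acyclic carriers: every
simplex is filled by coning from its first vertex. -/
def carrierHomotopy (f : ∀ n, OrderedChain R ι n →ₗ[R] OrderedChain R ι n) :
    ∀ n, OrderedChain R ι n →ₗ[R] OrderedChain R ι (n + 1)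
  | 0 => 0
  | n + 1 => Finsupp.linearCombination R fun s =>
      cone (s 0) (f (n + 1) (Finsupp.single s 1) - Finsupp.single s 1 -
        carrierHomotopy f n (boundary (Finsupp.single s 1)))

theorem boundary_carrierHomotopy {f : ∀ n, OrderedChain R ι n →ₗ[R] OrderedChain R ι n}
    (hf₀ : f 0 = LinearMap.id) (hf : ∀ n x, boundary (f (n + 1) x) = f n (boundary x))
    (n : ℕ) (x : OrderedChain R ι (n + 1)) :
    boundary (carrierHomotopy f (n + 1) x) =
      f (n + 1) x - x - carrierHomotopy f n (boundary x) := by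
  suffices boundary ∘ₗ carrierHomotopy f (n + 1) =
      f (n + 1) - LinearMap.id - carrierHomotopy f n ∘ₗ boundary from LinearMap.congr_fun this x
  ext s : 2
  simp only [carrierHomotopy, LinearMap.comp_apply, Finsupp.lsingle_apply, LinearMap.sub_apply,
    LinearMap.id_apply, Finsupp.linearCombination_single, one_smul]
  suffices boundary (f (n + 1) (Finsupp.single s 1) - Finsupp.single s 1 -
      carrierHomotopy f n (boundary (Finsupp.single s 1))) = 0 by
    rw [boundary_cone, this, map_zero, sub_zero]
  cases n with
  | zero => simp [hf, hf₀, carrierHomotopy]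
  | succ n =>
    simp only [map_sub, hf, boundary_carrierHomotopy hf₀ hf n, boundary_boundary, map_zero,
      sub_zero, sub_self]

theorem preservesVertices_carrierHomotopy
    {f : ∀ n, OrderedChain R ι n →ₗ[R] OrderedChain R ι n} (hf : ∀ n, PreservesVertices (f n)) :
    ∀ n, PreservesVertices (carrierHomotopy f n)
  | 0 => fun _ _ _ => Submodule.mem_comap.2 (Submodule.zero_mem _)
  | n + 1 => .of_single fun S s hs => by
    have hs' : Finsupp.single s (1 : R) ∈ onVertices R S (n + 1) := single_mem_onVertices hs 1
    have h_boundary := preservesVertices_boundary S hs'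
    rw [carrierHomotopy, Finsupp.linearCombination_single, one_smul]
    exact cone_mem_onVertices (hs 0) (Submodule.sub_mem _ (Submodule.sub_mem _ (hf _ S hs') hs')
      (preservesVertices_carrierHomotopy hf n S h_boundary))

/-! ### Alternating maps on ordered chains -/

/-- The linear map `f` changes sign when two consecutive vertices are exchanged, and vanishes when
they are equal. The first vertices are split off by `cone`, to which the boundary formula
applies. -/
def IsAlternating : ∀ {n}, (OrderedChain R ι n →ₗ[R] M) → Prop
  | 0, _ => True
  | 1, _ => True
  | _ + 2, f => (∀ v, IsAlternating (f ∘ₗ cone v)) ∧ (∀ v x, f (cone v (cone v x)) = 0) ∧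
      ∀ v w x, f (cone v (cone w x)) = -f (cone w (cone v x))

theorem IsAlternating.comp_cone {f : OrderedChain R ι (n + 1) →ₗ[R] M} (hf : IsAlternating f)
    (v : ι) : IsAlternating (f ∘ₗ cone v) := by
  cases n with
  | zero => trivial
  | succ n => exact hf.1 v

theorem IsAlternating.sub {f g : OrderedChain R ι n →ₗ[R] M} (hf : IsAlternating f)
    (hg : IsAlternating g) : IsAlternating (f - g) := by
  induction n using Nat.twoStepInduction with
  | zero => trivial
  | one => trivial
  | more n _ ih =>
    refine ⟨fun v => ih (hf.1 v) (hg.1 v), fun v x => ?_, fun v w x => ?_⟩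
    · simp [hf.2.1, hg.2.1]
    · rw [LinearMap.sub_apply, LinearMap.sub_apply, hf.2.2 v, hg.2.2 v, neg_sub_neg, neg_sub]

theorem IsAlternating.comp_boundary {f : OrderedChain R ι n →ₗ[R] M} (hf : IsAlternating f) :
    IsAlternating (f ∘ₗ boundary) := by
  induction n using Nat.twoStepInduction with
  | zero => trivial
  | one =>
    refine ⟨fun _ => trivial, fun v x => ?_, fun v w x => ?_⟩ <;>
      simp [boundary_cone, boundary_cone_zero]
  | more n _ ih =>
    have h_cone (v : ι) : (f ∘ₗ boundary) ∘ₗ cone v = f - (f ∘ₗ cone v) ∘ₗ boundary :=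
      LinearMap.ext fun x => by simp [boundary_cone]
    refine ⟨fun v => h_cone v ▸ hf.sub (ih (hf.1 v)), fun v x => ?_, fun v w x => ?_⟩
    · simp [boundary_cone, hf.2.1]
    · simp [boundary_cone, hf.2.2 v w]
      abel

theorem IsAlternating.linearCombination {f : OrderedChain R ι n →ₗ[R] M} (hf : IsAlternating f)
    (Φ : Set ι → M →ₗ[R] N) : IsAlternating
      (Finsupp.linearCombination R fun s => Φ (Set.range s) (f (Finsupp.single s 1))) := by
  induction n using Nat.twoStepInduction generalizing Φ with
  | zero => trivial
  | one => trivial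
  | more n _ ih =>
    set g := Finsupp.linearCombination R fun s => Φ (Set.range s) (f (Finsupp.single s 1)) with hg
    have h_pair (v w : ι) (s : Fin n → ι) : g (cone v (cone w (Finsupp.single s 1))) =
        Φ (insert v (insert w (Set.range s))) (f (cone v (cone w (Finsupp.single s 1)))) := by
      simp [hg, Fin.range_cons]
    refine ⟨fun v => ?_, fun v x => ?_, fun v w x => ?_⟩
    · convert ih (hf.1 v) (fun S => Φ (insert v S)) using 1
      ext s : 2
      simp [hg, Fin.range_cons]
    · suffices (g ∘ₗ cone v) ∘ₗ cone v = 0 from LinearMap.congr_fun this x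
      ext s : 2
      simp [-cone_single, h_pair, hf.2.1]
    · suffices (g ∘ₗ cone v) ∘ₗ cone w = -((g ∘ₗ cone w) ∘ₗ cone v) from
        LinearMap.congr_fun this x
      ext s : 2
      simp [-cone_single, h_pair, hf.2.2 v w, Set.insert_comm v w]

theorem IsAlternating.map_cone_single_eq_zero {f : OrderedChain R ι (n + 1) →ₗ[R] M}
    (hf : IsAlternating f) {v : ι} {s : Fin n → ι} (hv : v ∈ Set.range s) :
    f (cone v (Finsupp.single s 1)) = 0 := by
  induction n with
  | zero => exact (IsEmpty.exists_iff.1 hv).elim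
  | succ n ih =>
    obtain ⟨w, t, rfl⟩ : ∃ w t, s = Fin.cons w t := ⟨_, _, (Fin.cons_self_tail s).symm⟩
    rw [← cone_single]
    rcases (Fin.range_cons w t ▸ hv : v ∈ insert w (Set.range t)) with rfl | hvt
    · exact hf.2.1 v _
    · rw [hf.2.2, neg_eq_zero]
      exact ih (hf.comp_cone w) hvt

theorem IsAlternating.map_single_eq_zero {f : OrderedChain R ι n →ₗ[R] M} (hf : IsAlternating f)
    {s : Fin n → ι} (hs : ¬ Function.Injective s) : f (Finsupp.single s 1) = 0 := by
  induction n with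
  | zero => exact (hs (Function.injective_of_subsingleton s)).elim
  | succ n ih =>
    obtain ⟨v, t, rfl⟩ : ∃ v t, s = Fin.cons v t := ⟨_, _, (Fin.cons_self_tail s).symm⟩
    rw [← cone_single]
    rw [Fin.cons_injective_iff, not_and_or, not_not] at hs
    exact hs.elim hf.map_cone_single_eq_zero (ih (hf.comp_cone v))

/-! ### Barycentric subdivision -/

open Classical in
/-- The cone from a vertex chosen in `S`; zero if `S` is empty. -/
def apexCone (S : Set ι) : OrderedChain R ι n →ₗ[R] OrderedChain R ι (n + 1) :=
  if h : S.Nonempty then cone h.some else 0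

theorem exists_apexCone_eq_cone {S : Set ι} (hS : S.Nonempty) :
    ∃ v ∈ S, (apexCone S : OrderedChain R ι n →ₗ[R] _) = cone v :=
  ⟨hS.some, hS.some_mem, dif_pos hS⟩

/-- Barycentric subdivision, followed by the simplicial map that sends the barycentre of a face to
a vertex chosen in that face. The choice depends only on the set of vertices of the face. -/
def subdivision (R ι : Type*) [Ring R] : ∀ n, OrderedChain R ι n →ₗ[R] OrderedChain R ι n
  | 0 => LinearMap.id
  | n + 1 => Finsupp.linearCombination R fun s =>
      apexCone (Set.range s) (subdivision R ι n (boundary (Finsupp.single s 1)))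

theorem exists_subdivision_single_eq_cone (s : Fin (n + 1) → ι) :
    ∃ v ∈ Set.range s, subdivision R ι (n + 1) (Finsupp.single s 1) =
      cone v (subdivision R ι n (boundary (Finsupp.single s 1))) := by
  obtain ⟨v, hv, h_apex⟩ := exists_apexCone_eq_cone (R := R) (n := n) (Set.range_nonempty s)
  exact ⟨v, hv, by rw [subdivision, Finsupp.linearCombination_single, one_smul, h_apex]⟩

theorem boundary_subdivision (n : ℕ) (x : OrderedChain R ι (n + 1)) :
    boundary (subdivision R ι (n + 1) x) = subdivision R ι n (boundary x) := by
  suffices boundary ∘ₗ subdivision R ι (n + 1) = subdivision R ι n ∘ₗ boundary from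
    LinearMap.congr_fun this x
  ext s : 2
  obtain ⟨v, -, hv⟩ := exists_subdivision_single_eq_cone (R := R) s
  simp only [LinearMap.comp_apply, Finsupp.lsingle_apply, hv]
  cases n with
  | zero => exact boundary_cone_zero v _
  | succ n =>
    rw [boundary_cone, boundary_subdivision n, boundary_boundary, map_zero, map_zero, sub_zero]

theorem preservesVertices_subdivision : ∀ n, PreservesVertices (subdivision R ι n)
  | 0 => fun _ => le_rfl
  | n + 1 => .of_single fun S s hs => by
    obtain ⟨_, ⟨i, rfl⟩, h_cone⟩ := exists_subdivision_single_eq_cone (R := R) s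
    rw [h_cone]
    exact cone_mem_onVertices (hs i) (preservesVertices_subdivision n S
      (preservesVertices_boundary S (single_mem_onVertices hs 1)))

theorem isAlternating_subdivision : ∀ n, IsAlternating (subdivision R ι n)
  | 0 => trivial
  | n + 1 => (isAlternating_subdivision n).comp_boundary.linearCombination apexCone

end OrderedChain

end OrderedChains

/-! ### Cocycles on nerves -/

section Nerve

open OrderedChain

variable {Y ι : Type u} {U : ι → Set Y} {R : Type v} [CommRing R] {n : ℕ}

open Classical in
/-- Evaluation of a cochain on ordered chains, by zero on tuples that span no simplex of the
nerve. -/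
def Cochain.eval (c : Cochain U R n) : OrderedChain R ι (n + 1) →ₗ[R] R :=
  Finsupp.linearCombination R fun s => if hs : (⋂ i, U (s i)).Nonempty then c ⟨s, hs⟩ else 0

theorem Cochain.eval_single (c : Cochain U R n) (s : Simplex U n) :
    c.eval (Finsupp.single s.1 1) = c s := by
  rw [Cochain.eval, Finsupp.linearCombination_single, one_smul, dif_pos s.2]
  rfl

theorem coboundary_comp_single (L : OrderedChain R ι (n + 1) →ₗ[R] R) (s : Simplex U (n + 1)) :
    coboundary (fun t : Simplex U n => L (Finsupp.single t.1 1)) s =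
      L (boundary (Finsupp.single s.1 1)) := by
  simp only [boundary_single, map_sum, coboundary]
  refine Finset.sum_congr rfl fun i _ => ?_
  rw [← Finsupp.smul_single_one (s.1 ∘ i.succAbove), map_smul, smul_eq_mul]
  rfl

theorem Cochain.eval_boundary_eq_zero {c : Cochain U R n} (hc : coboundary c = 0)
    {S : Set ι} (hS : (⋂ i ∈ S, U i).Nonempty) {x : OrderedChain R ι (n + 2)}
    (hx : x ∈ onVertices R S (n + 2)) : c.eval (boundary x) = 0 := by
  suffices onVertices R S (n + 2) ≤ (c.eval ∘ₗ boundary).ker from this hx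
  refine onVertices_le_iff.2 fun t ht => LinearMap.mem_ker.2 ?_
  have ht' : (⋂ i, U (t i)).Nonempty :=
    hS.mono fun y hy => Set.mem_iInter.2 fun i => Set.mem_iInter₂.1 hy (t i) (ht i)
  have h_coboundary := coboundary_comp_single c.eval ⟨t, ht'⟩
  simp only [Cochain.eval_single] at h_coboundary
  exact h_coboundary.symm.trans (congrFun hc _)

theorem isCoboundary_of_forall_not_injective (hU : ∀ s : Simplex U n, ¬ Function.Injective s.1)
    {c : Cochain U R n} (hc : coboundary c = 0) : IsCoboundary c := by
  cases n with
  | zero => exact .inl (funext fun s => (hU s fun i j _ => Fin.ext (by omega)).elim)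
  | succ n =>
    let H := carrierHomotopy (subdivision R ι)
    refine .inr ⟨n, rfl, fun t => -c.eval (H (n + 1) (Finsupp.single t.1 1)), fun s => ?_⟩
    have h_simplex : (⋂ i ∈ Set.range s.1, U i).Nonempty := by simpa using s.2
    have h_subdivision : subdivision R ι (n + 2) (Finsupp.single s.1 1) = 0 :=
      (isAlternating_subdivision _).map_single_eq_zero (hU s)
    have h_homotopy : c.eval (boundary (H (n + 2) (Finsupp.single s.1 1))) = 0 :=
      Cochain.eval_boundary_eq_zero hc h_simplex
        (preservesVertices_carrierHomotopy preservesVertices_subdivision _ _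
          (single_mem_onVertices Set.mem_range_self 1))
    rw [boundary_carrierHomotopy rfl boundary_subdivision, h_subdivision, zero_sub, map_sub,
      map_neg, c.eval_single, sub_eq_zero] at h_homotopy
    rw [← neg_neg (c s), h_homotopy]
    exact (coboundary_comp_single (-(c.eval ∘ₗ H (n + 1))) s).symm

end Nerve

/-! ### Classes represented on the nerve of a given cover -/

section Represented

variable {Y Z : Type u} [TopologicalSpace Y] [TopologicalSpace Z] {R : Type v} [CommRing R]
  {𝒱 𝒲 : FinCover Y} {k n p q : ℕ}

/-- The class `ξ` is represented by a cocycle on the nerve of `𝒱`. For `𝒱 = 𝒰 ∩ Y` this is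
membership in `Ȟⁿ(Y; 𝒰; R)`. -/
def RepresentedOn (𝒱 : FinCover Y) (ξ : CechH Y R n) : Prop :=
  ∃ (c : Cochain 𝒱.U R n) (hc : coboundary c = 0), ξ = Quot.mk _ ⟨𝒱, c, hc⟩

theorem CechCocycle.representedOn (x : CechCocycle Y R n) :
    RepresentedOn x.cover (Quot.mk _ x : CechH Y R n) :=
  ⟨x.cochain, x.closed, rfl⟩

theorem RepresentedOn.of_refines {ξ : CechH Y R n} (hξ : RepresentedOn 𝒲 ξ)
    (h : ∀ j, ∃ i, 𝒱.U j ⊆ 𝒲.U i) : RepresentedOn 𝒱 ξ := by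
  obtain ⟨c, hc, rfl⟩ := hξ
  choose π hπ using h
  exact ⟨pull id π hπ c, coboundary_pull_eq_zero _ _ _ hc,
    Quot.sound ⟨π, hπ, Or.inl (sub_self _)⟩⟩

theorem representedOn_one : RepresentedOn 𝒱 (1 : CechH Y R 0) :=
  RepresentedOn.of_refines (CechCocycle.representedOn _) fun _ =>
    ⟨PUnit.unit, Set.subset_univ _⟩

theorem RepresentedOn.cup {ξ : CechH Y R p} {ζ : CechH Y R q}
    (hξ : RepresentedOn 𝒱 ξ) (hζ : RepresentedOn 𝒱 ζ) : RepresentedOn 𝒱 (CechH.cup ξ ζ) := by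
  obtain ⟨c, hc, rfl⟩ := hξ
  obtain ⟨e, he, rfl⟩ := hζ
  exact (CechCocycle.representedOn (CechCocycle.cup ⟨𝒱, c, hc⟩ ⟨𝒱, e, he⟩)).of_refines fun j =>
    ⟨(j, j), (Set.inter_self _).ge⟩

theorem RepresentedOn.cupList {l : List (CechH Y R k)} (hl : ∀ ξ ∈ l, RepresentedOn 𝒱 ξ) :
    RepresentedOn 𝒱 (CechH.cupList l) := by
  induction l with
  | nil => exact representedOn_one
  | cons ξ l ih =>
    rw [List.forall_mem_cons] at hl
    exact (ih hl.2).cup hl.1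

theorem RepresentedOn.map {ξ : CechH Y R n} (hξ : RepresentedOn 𝒱 ξ) (f : C(Z, Y)) :
    RepresentedOn (𝒱.preimage f) (CechH.map f ξ) := by
  obtain ⟨c, hc, rfl⟩ := hξ
  exact ⟨_, _, rfl⟩

theorem RepresentedOn.eq_zero {ξ : CechH Y R n} (hξ : RepresentedOn 𝒱 ξ)
    (h𝒱 : ∀ s : Simplex 𝒱.U n, ¬ Function.Injective s.1) : ξ = 0 := by
  obtain ⟨c, hc, rfl⟩ := hξ
  refine (Quot.sound ⟨fun _ => PUnit.unit, fun _ _ _ => trivial, ?_⟩).symm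
  exact isCoboundary_of_forall_not_injective h𝒱 ((congrArg coboundary (sub_zero c)).trans hc)

end Represented

/-! ### Covers of the space and of its subsets -/

section CoverLemmas

variable {X : Type u} {Y Z : Set X} {𝒰 𝒱 : Set (Set X)}

theorem ncard_le_ord (h : 𝒱.Finite) (x : X) : ({V ∈ 𝒱 | x ∈ V}.ncard : ℤ) ≤ ord 𝒱 + 1 := by
  have h_bdd : BddAbove (Set.range fun x : X => {V ∈ 𝒱 | x ∈ V}.ncard) :=
    ⟨𝒱.ncard, Set.forall_mem_range.2 fun _ => Set.ncard_le_ncard (Set.sep_subset _ _) h⟩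
  rw [ord, sub_add_cancel]
  exact_mod_cast le_ciSup h_bdd x

theorem Refines.refl (𝒰 : Set (Set X)) : Refines 𝒰 𝒰 :=
  fun U hU => ⟨U, hU, subset_rfl⟩

theorem neg_one_le_ord (𝒱 : Set (Set X)) : -1 ≤ ord 𝒱 := by
  rw [ord]
  omega

variable [TopologicalSpace X]

theorem exists_ord_eq_coverDim (h : IsFinOpenCover Y 𝒰) :
    ∃ 𝒱, IsFinOpenCover Y 𝒱 ∧ Refines 𝒱 𝒰 ∧ ord 𝒱 = coverDim Y 𝒰 :=
  Int.csInf_mem (s := {n | ∃ 𝒱, IsFinOpenCover Y 𝒱 ∧ Refines 𝒱 𝒰 ∧ ord 𝒱 = n})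
    ⟨ord 𝒰, 𝒰, h, .refl 𝒰, rfl⟩ ⟨-1, fun _ ⟨𝒱, _, _, h_ord⟩ => h_ord ▸ neg_one_le_ord 𝒱⟩

theorem IsFinOpenCover.mono (h : IsFinOpenCover Y 𝒰) (hZ : Z ⊆ Y) : IsFinOpenCover Z 𝒰 :=
  { h with covers := hZ.trans h.covers }

theorem IsFinOpenCover.not_injective_simplex_restrict (h : IsFinOpenCover Y 𝒱) {n : ℕ}
    (hn : ord 𝒱 < n) (s : Simplex h.restrict.U n) : ¬ Function.Injective s.1 := by
  intro hs
  obtain ⟨y, hy⟩ := s.2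
  choose V hV h_trace using fun i => (s.1 i).2.2
  have hV_injective : Function.Injective V := fun i j hij =>
    hs (Subtype.ext (by rw [h_trace i, h_trace j, hij]))
  have h_range : Set.range V ⊆ {W ∈ 𝒱 | y.1 ∈ W} := by
    rintro _ ⟨i, rfl⟩
    exact ⟨hV i, (h_trace i).subset (Set.mem_iInter.1 hy i)⟩
  have h_card : n + 1 ≤ {W ∈ 𝒱 | y.1 ∈ W}.ncard := by
    simpa [Set.ncard_range_of_injective hV_injective] using
      Set.ncard_le_ncard h_range (h.finite.subset (Set.sep_subset _ _))
  have h_ord := ncard_le_ord h.finite y.1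
  omega

/-- The cover `𝒰` of a closed set `Y`, completed by the complement of `Y` to a cover of the
space. The emptiness test matters only when `Y` is the whole space. -/
def completeCover (Y : Set X) (𝒰 : Set (Set X)) : Set (Set X) :=
  {U | U.Nonempty ∧ (U ∈ 𝒰 ∨ U = Yᶜ)}

theorem IsFinOpenCover.completeCover (hY : IsClosed Y) (h : IsFinOpenCover Y 𝒰) :
    IsFinOpenCover Set.univ (completeCover Y 𝒰) where
  finite := (h.finite.insert Yᶜ).subset fun _ hU => hU.2.symm
  isOpen := by
    rintro U ⟨-, hU | rfl⟩
    exacts [h.isOpen U hU, hY.isOpen_compl]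
  nonempty := fun _ hU => hU.1
  covers := fun x _ => by
    by_cases hx : x ∈ Y
    · obtain ⟨U, hU, hxU⟩ := h.covers hx
      exact ⟨U, ⟨⟨x, hxU⟩, Or.inl hU⟩, hxU⟩
    · exact ⟨Yᶜ, ⟨⟨x, hx⟩, Or.inr rfl⟩, hx⟩

end CoverLemmas

/-! ### Orbits of classes and mean dimension -/

section Dynamics

variable {G : Type*} [Group G] {X : Type u} [MulAction G X]
  {Y : Set X} {𝒰 𝒱 : Set (Set X)} {F F₀ : Finset G}

theorem exists_smul_mem_of_refines_dynJoin (h𝒱 : Refines 𝒱 (dynJoin F (completeCover Y 𝒰)))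
    {V : Set X} (hV : V ∈ 𝒱) {g : G} (hg : g ∈ F) {x : X} (hx : x ∈ V) (hxY : g • x ∈ Y) :
    ∃ U ∈ 𝒰, ∀ y ∈ V, g • y ∈ U := by
  obtain ⟨_, ⟨-, U, hU, rfl⟩, hVU⟩ := h𝒱 V hV
  have h_subset : ∀ y ∈ V, g • y ∈ U g := fun y hy => Set.mem_iInter₂.1 (hVU hy) g hg
  refine ⟨U g, (hU g hg).2.resolve_right fun h_compl => ?_, h_subset⟩
  exact (h_compl ▸ h_subset x hx : g • x ∈ Yᶜ) hxY

variable [TopologicalSpace X]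

theorem ofReal_le_mdim (h𝒰 : IsFinOpenCover Set.univ 𝒰) {r : ℝ}
    (h : ∀ (G₀ : Finset G) (δ : ℝ), 0 < δ → ∃ F : Finset G, IsInvariant G₀ δ F ∧
      r ≤ (coverDim Set.univ (dynJoin F 𝒰) : ℝ) / F.card) :
    ENNReal.ofReal r ≤ mdim G X := by
  refine le_iSup₂_of_le 𝒰 h𝒰 (le_iInf fun G₀ => le_iInf₂ fun δ hδ => ?_)
  obtain ⟨F, hF, h_le⟩ := h G₀ δ hδ
  exact le_iSup₂_of_le F hF (ENNReal.ofReal_le_ofReal h_le)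

variable [ContinuousConstSMul G X]

theorem IsFinOpenCover.dynJoin (h : IsFinOpenCover Set.univ 𝒰) (F : Finset G) :
    IsFinOpenCover Set.univ (dynJoin F 𝒰) where
  finite := by
    have := h.finite.to_subtype
    refine (Set.finite_range fun V : F → 𝒰 => ⋂ g : F, {x : X | g.1 • x ∈ (V g).1}).subset ?_
    rintro _ ⟨-, V, hV, rfl⟩
    refine ⟨fun g => ⟨V g.1, hV g.1 g.2⟩, ?_⟩
    ext x
    simp
  isOpen := by
    rintro _ ⟨-, V, hV, rfl⟩
    exact isOpen_biInter_finset fun g hg =>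
      (h.isOpen _ (hV g hg)).preimage (continuous_const_smul g)
  nonempty := fun _ hW => hW.1
  covers := fun x _ => by
    choose V hV hx using fun g : G => h.covers (Set.mem_univ (g • x))
    have hmem : x ∈ ⋂ g ∈ F, {y : X | g • y ∈ V g} := Set.mem_iInter₂.2 fun g _ => hx g
    exact ⟨_, ⟨⟨x, hmem⟩, V, fun g _ => hV g, rfl⟩, hmem⟩

variable {R : Type v} [CommRing R] {k : ℕ}

theorem RepresentedOn.map_translate {h𝒰 : IsFinOpenCover Y 𝒰} {η : CechH Y R k}
    (hη : RepresentedOn h𝒰.restrict η) (hF : F₀ ⊆ F)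
    (h𝒱 : IsFinOpenCover (interPreimage F₀ Y) 𝒱)
    (h_ref : Refines 𝒱 (MeanCoh.dynJoin F (MeanCoh.completeCover Y 𝒰))) (g : F₀) :
    RepresentedOn h𝒱.restrict (CechH.map (translate F₀ Y g) η) := by
  refine (hη.map (translate F₀ Y g)).of_refines ?_
  rintro ⟨_, ⟨x, hx⟩, V, hV, rfl⟩
  have hxY : g.1 • x.1 ∈ Y := x.2 g.1 g.2
  obtain ⟨U, hU, h_maps⟩ := exists_smul_mem_of_refines_dynJoin h_ref hV (hF g.2) hx hxY
  exact ⟨⟨Subtype.val ⁻¹' U, ⟨⟨_, hxY⟩, h_maps x hx⟩, U, hU, rfl⟩, fun y hy => h_maps y hy⟩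

theorem orbitCup_eq_zero_of_coverDim_lt (hY : IsClosed Y) {h𝒰 : IsFinOpenCover Y 𝒰}
    {η : CechH Y R k} (hη : η ∈ cechFrom h𝒰 R k) (hF : F₀ ⊆ F) {l : List F₀}
    (h_lt : coverDim Set.univ (MeanCoh.dynJoin F (MeanCoh.completeCover Y 𝒰)) <
      ((k * l.length : ℕ) : ℤ)) : orbitCup F₀ Y η l = 0 := by
  obtain ⟨𝒱, h𝒱, h_ref, h_ord⟩ := exists_ord_eq_coverDim ((h𝒰.completeCover hY).dynJoin F)
  have h𝒱_restrict : IsFinOpenCover (interPreimage F₀ Y) 𝒱 := h𝒱.mono (Set.subset_univ _)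
  have h_represented : RepresentedOn h𝒱_restrict.restrict (orbitCup F₀ Y η l) :=
    .cupList <| List.forall_mem_map.2 fun g _ =>
      RepresentedOn.map_translate (h𝒰 := h𝒰) hη hF h𝒱_restrict h_ref g
  refine h_represented.eq_zero (h𝒱_restrict.not_injective_simplex_restrict ?_)
  rwa [h_ord, List.length_map]

theorem degree_le_coverDim (hY : IsClosed Y) {h𝒰 : IsFinOpenCover Y 𝒰} {η : CechH Y R k}
    (hη : η ∈ cechFrom h𝒰 R k) (hF : F₀ ⊆ F) {l : List F₀} (hl : l.Nodup) (hl' : ∀ g, g ∈ l)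
    (hne : orbitCup F₀ Y η l ≠ 0) :
    ((k * F₀.card : ℕ) : ℤ) ≤
      coverDim Set.univ (MeanCoh.dynJoin F (MeanCoh.completeCover Y 𝒰)) := by
  classical
  have h_length : l.length = F₀.card := by
    rw [← List.toFinset_card_of_nodup hl,
      Finset.eq_univ_iff_forall.2 fun g => List.mem_toFinset.2 (hl' g), Finset.card_univ,
      Fintype.card_coe]
  rw [← h_length]
  exact not_lt.1 fun h_lt => hne (orbitCup_eq_zero_of_coverDim_lt hY hη hF h_lt)

end Dynamics

end MeanCoh

end

theorem mainTheorem6_general {G : Type*} [Group G] (_ : MeanCoh.IsAmenable G)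
    {X : Type*} [TopologicalSpace X] [MulAction G X] [ContinuousConstSMul G X]
    (R : Type*) [CommRing R] (k : ℕ) :
    MeanCoh.mcid G X R k ≤ MeanCoh.mdim G X := by
  refine iSup₂_le fun d hd => ENNReal.le_of_forall_pos_le_add fun ε hε _ => ?_
  obtain ⟨Y, hY, 𝒰, h𝒰, -, η, hη, h_independent⟩ := hd ε hε
  suffices ENNReal.ofReal (d - ε) ≤ MeanCoh.mdim G X by
    rwa [ENNReal.ofReal_sub _ ε.coe_nonneg, ENNReal.ofReal_coe_nnreal, ENNReal.ofReal_coe_nnreal,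
      tsub_le_iff_right] at this
  refine MeanCoh.ofReal_le_mdim (h𝒰.completeCover hY) fun G₀ δ hδ => ?_
  obtain ⟨F, hF, F₀, hF₀, ⟨l, hl, hl', h_ne⟩, h_lt⟩ := h_independent G₀ δ hδ
  have h_degree : (k : ℝ) * F₀.card ≤
      MeanCoh.coverDim Set.univ (MeanCoh.dynJoin F (MeanCoh.completeCover Y 𝒰)) := by
    exact_mod_cast MeanCoh.degree_le_coverDim hY hη hF₀ hl hl' h_ne
  exact ⟨F, hF, h_lt.le.trans (div_le_div_of_nonneg_right h_degree F.card.cast_nonneg)⟩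

theorem mainTheorem6 {G : Type*} [Group G] [Countable G] (hG : MeanCoh.IsAmenable G)
    {X : Type*} [TopologicalSpace X] [CompactSpace X] [TopologicalSpace.MetrizableSpace X]
    [MulAction G X] [ContinuousConstSMul G X] (R : Type*) [CommRing R] (k : ℕ) (hk : Even k) :
    MeanCoh.mcid G X R k ≤ MeanCoh.mdim G X :=
  mainTheorem6_general hG R k
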